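/- **Theorem (Tutte's Wheel Theorem).** Every minimally 3-connected finite graph is a wheel. Here graphs are regarded as multigraphs. A graph is *3-connected* if it has no loops and no parallel edges, has more than three vertices, and cannot be disconnected by deleting fewer than three vertices. For an edge $e$ of $G$, $G-e$ is obtained by deleting $e$, and $G/e$ is the multigraph obtained by contracting $e$, that is, by deleting $e$ and identifying its two ends while keeping all other edges (so parallel edges may arise, in which case $G/e$ is not 3-connected). $G$ is *minimally 3-connected* if it is 3-connected and for every edge $e$ of $G$ neither $G-e$ nor $G/e$ is 3-connected. A *wheel* is a simple graph that consists of a cycle of length $n$, for some $n\ge 3$, together with one further vertex adjacent to all vertices of the cycle. -/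

import Mathlib

open scoped Graph

namespace Graph

/-- A multigraph is connected if it is nonempty and any two of its vertices are joined by a walk.
Loops and parallel edges are irrelevant here, so this is read off the underlying simple graph. -/
def IsConnected {α β : Type*} (G : Graph α β) : Prop :=
  G.toSimpleGraph.Connected

/-- `G` has more than `k` vertices, and deleting fewer than `k` vertices does not disconnect it. -/
def IsVertexConnected {α β : Type*} (k : ℕ) (G : Graph α β) : Prop :=
  (k : ℕ∞) < V(G).encard ∧
    ∀ X : Set α, X ⊆ V(G) → X.encard < (k : ℕ∞) → (G.deleteVerts X).IsConnected

/-- A 3-connected (multi-)graph. By convention such a graph has no loops and no parallel edges. -/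
def IsThreeConnected {α β : Type*} (G : Graph α β) : Prop :=
  G.Simple ∧ G.IsVertexConnected 3

/-- The multigraph `G / e`: the edge `e` is removed and its two ends are identified.
All other edges are kept, so loops and parallel edges may arise. -/
def contractEdge {α β : Type*} (G : Graph α β) (e : β) : Graph (Quot (G.IsLink e)) β :=
  (G.deleteEdges {e}).map (Quot.mk (G.IsLink e))

/-- `G` is 3-connected, but for no edge `e` is `G - e` or `G / e` 3-connected. -/
def IsMinimallyThreeConnected {α β : Type*} (G : Graph α β) : Prop :=
  G.IsThreeConnected ∧
    ∀ e ∈ E(G), ¬ (G.deleteEdges {e}).IsThreeConnected ∧ ¬ (G.contractEdge e).IsThreeConnected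

/-- The `n`-wheel: a cycle of length `n` on the vertices `some i` (the rim), together with a
further vertex `none` (the centre) that is adjacent to every vertex of the cycle. -/
def wheelGraph (n : ℕ) : SimpleGraph (Option (Fin n)) :=
  (SimpleGraph.cycleGraph n).map Function.Embedding.some ⊔ SimpleGraph.starGraph none

/-- `G` is a wheel: it has no loops or parallel edges, and as a simple graph it is isomorphic to
the `n`-wheel for some `n ≥ 3`. -/
def IsWheel {α β : Type*} (G : Graph α β) : Prop :=
  G.Simple ∧ ∃ n : ℕ, 3 ≤ n ∧ Nonempty (G.toSimpleGraph ≃g wheelGraph n)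

end Graph

/-! Call a vertex cubic if it has degree three. In a 3-connected graph, if `G - e` is not
3-connected, at most two vertices separate the ends of `e` in `G - e`. If `G / e` is not
3-connected, the ends of `e` have a common neighbour or lie together in a 3-separator. Crossing two
such separations leaves corners with at most two outside neighbours; 3-connectivity makes these
corners empty.

This gives three facts. In a triangle every edge has a cubic end (`isCubicAt_or_of_triangle`). Every
edge at a cubic vertex lies in a triangle (`adj_or_adj_of_cubic`). There is a triangle
(`exists_triangle`), by taking a smallest side of a 3-separation whose separator contains an edge.

So cubic vertices exist. If a noncubic `y` has a cubic neighbour, the cubic neighbours of `y` form a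
set whose only outside neighbour is `y`, hence they are all the other vertices. Otherwise
connectivity makes all vertices cubic, and the triangles at a vertex force it to be adjacent to all
others. In both cases deleting this hub leaves a connected 2-regular graph, that is, a cycle. -/

namespace SimpleGraph

variable {V : Type*} {H : SimpleGraph V}

/-! ### Small cuts, separations and uncrossing -/

/-- No set of at most two vertices `{p, q}` cuts off a nonempty set `A` from a further vertex. -/
def NoSmallCut (H : SimpleGraph V) : Prop :=
  ∀ (A : Set V) (p q : V), (∀ a ∈ A, ∀ b, H.Adj a b → b ∈ A ∨ b = p ∨ b = q) →
    ∀ c, c ∉ A → c ≠ p → c ≠ q → ∀ x, x ∉ A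

/-- All neighbours of `v` are among three vertices. -/
def IsCubicAt (H : SimpleGraph V) (v : V) : Prop :=
  ∃ x y z, ∀ u, H.Adj v u → u = x ∨ u = y ∨ u = z

/-- `X`, `S`, `T` partition the vertices, and `S`, `T` are nonempty. -/
structure IsTripartition (X S T : Set V) : Prop where
  left_nonempty : S.Nonempty
  right_nonempty : T.Nonempty
  cover : ∀ u, u ∈ S ∨ u ∈ T ∨ u ∈ X
  disj : ∀ u ∈ S, u ∉ T
  left_disj : ∀ u ∈ S, u ∉ X
  right_disj : ∀ u ∈ T, u ∉ X

/-- The set `X` separates `S` from `T` in `H`. -/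
structure IsSeparation (H : SimpleGraph V) (X S T : Set V) : Prop extends
    IsTripartition X S T where
  not_adj : ∀ s ∈ S, ∀ t ∈ T, ¬ H.Adj s t

lemma IsTripartition.symm {X S T : Set V} (h : IsTripartition X S T) : IsTripartition X T S where
  left_nonempty := h.right_nonempty
  right_nonempty := h.left_nonempty
  cover u := by have := h.cover u; tauto
  disj u hu hu' := h.disj u hu' hu
  left_disj := h.right_disj
  right_disj := h.left_disj

lemma IsSeparation.symm {X S T : Set V} (h : H.IsSeparation X S T) : H.IsSeparation X T S where
  toIsTripartition := h.toIsTripartition.symm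
  not_adj s hs t ht hst := h.not_adj t ht s hs hst.symm

set_option maxHeartbeats 1000000 in
/-- Uncrossing the separations belonging to the undeletable edges `ab` and `bc` of a triangle. -/
lemma NoSmallCut.isCubicAt_or_of_uncross (hP : H.NoSmallCut) {a b c v w : V} {A B B' C' : Set V}
    (ha : a ∈ A) (hb : b ∈ B) (hb' : b ∈ B') (hc' : c ∈ C')
    (h₁ : IsTripartition {c, v} A B) (h₂ : IsTripartition {a, w} B' C')
    (e₁ : ∀ s ∈ A, ∀ t ∈ B, H.Adj s t → s = a ∧ t = b)
    (e₂ : ∀ s ∈ B', ∀ t ∈ C', H.Adj s t → s = b ∧ t = c) :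
    H.IsCubicAt a ∨ H.IsCubicAt b := by
  obtain ⟨-, -, k₁, d₁, l₁, r₁⟩ := h₁
  obtain ⟨-, -, k₂, d₂, l₂, r₂⟩ := h₂
  simp only [Set.mem_insert_iff, Set.mem_singleton_iff, not_or] at k₁ l₁ r₁ k₂ l₂ r₂
  have eB : ∀ t ∈ B, ∀ s, H.Adj t s → s ∈ B ∨ s = c ∨ s = v ∨ (s = a ∧ t = b) := by
    intro t ht s hs
    have := k₁ s
    have := e₁ s
    grind [H.adj_comm]
  have eA : ∀ s ∈ A, ∀ t, H.Adj s t → t ∈ A ∨ t = c ∨ t = v ∨ (s = a ∧ t = b) := by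
    intro s hs t ht
    have := k₁ t
    grind
  have eC : ∀ t ∈ C', ∀ s, H.Adj t s → s ∈ C' ∨ s = a ∨ s = w ∨ (s = b ∧ t = c) := by
    intro t ht s hs
    have := k₂ s
    have := e₂ s
    grind [H.adj_comm]
  have eB' : ∀ s ∈ B', ∀ t, H.Adj s t → t ∈ B' ∨ t = a ∨ t = w ∨ (s = b ∧ t = c) := by
    intro s hs t ht
    have := k₂ t
    grind
  -- Each `q` treats one corner. In `A ∩ B'` the vertex `c` is no outside neighbour, because the
  -- only edge from `B'` to `C'` is `bc` and `b ∉ A`. The hypothesis on `v` and `w` leaves only one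
  -- of these as an outside neighbour besides `a`. The other corners are similar; in `B ∩ B'` the
  -- vertex `b` is moved into the cut.
  have q₁ : (v = w ∨ v ∈ C' ∨ w ∈ B) → ∀ x, x ∉ A ∩ B' := by
    intro h
    rcases h with h | h | h
    · exact hP _ a v (fun s hs t ht ↦ by
        have i₁ := eA s hs.1 t ht
        have i₂ := eB' s hs.2 t ht
        clear eA eB eC eB' e₁ e₂ hP
        grind) b (by grind) (by grind) (by grind)
    · exact hP _ a w (fun s hs t ht ↦ by
        have i₁ := eA s hs.1 t ht
        have i₂ := eB' s hs.2 t ht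
        clear eA eB eC eB' e₁ e₂ hP
        grind) b (by grind) (by grind) (by grind)
    · exact hP _ a v (fun s hs t ht ↦ by
        have i₁ := eA s hs.1 t ht
        have i₂ := eB' s hs.2 t ht
        clear eA eB eC eB' e₁ e₂ hP
        grind) b (by grind) (by grind) (by grind)
  have q₂ : (v = w ∨ v ∈ B' ∨ w ∈ A) → ∀ x, x ∉ B ∩ C' := by
    intro h
    rcases h with h | h | h
    · exact hP _ c v (fun s hs t ht ↦ by
        have i₁ := eB s hs.1 t ht
        have i₂ := eC s hs.2 t ht
        clear eA eB eC eB' e₁ e₂ hP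
        grind) a (by grind) (by grind) (by grind)
    · exact hP _ c w (fun s hs t ht ↦ by
        have i₁ := eB s hs.1 t ht
        have i₂ := eC s hs.2 t ht
        clear eA eB eC eB' e₁ e₂ hP
        grind) b (by grind) (by grind) (by grind)
    · exact hP _ c v (fun s hs t ht ↦ by
        have i₁ := eB s hs.1 t ht
        have i₂ := eC s hs.2 t ht
        clear eA eB eC eB' e₁ e₂ hP
        grind) a (by grind) (by grind) (by grind)
  have q₃ : (v = w ∨ v ∈ C' ∨ w ∈ A) → ∀ x, x ∉ (B ∩ B') \ {b} := by
    intro h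
    rcases h with h | h | h
    · exact hP _ b v (fun s hs t ht ↦ by
        have i₁ := eB s hs.1.1 t ht
        have i₂ := eB' s hs.1.2 t ht
        clear eA eB eC eB' e₁ e₂ hP
        grind) a (by grind) (by grind) (by grind)
    · exact hP _ b w (fun s hs t ht ↦ by
        have i₁ := eB s hs.1.1 t ht
        have i₂ := eB' s hs.1.2 t ht
        clear eA eB eC eB' e₁ e₂ hP
        grind) c (by grind) (by grind) (by grind)
    · exact hP _ b v (fun s hs t ht ↦ by
        have i₁ := eB s hs.1.1 t ht
        have i₂ := eB' s hs.1.2 t ht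
        clear eA eB eC eB' e₁ e₂ hP
        grind) a (by grind) (by grind) (by grind)
  have q₄ : v ∈ B' → w ∈ B → ∀ x, x ∉ A ∩ C' := by
    intro h h'
    exact hP _ a c (fun s hs t ht ↦ by
        have i₁ := eA s hs.1 t ht
        have i₂ := eC s hs.2 t ht
        clear eA eB eC eB' e₁ e₂ hP
        grind) b (by grind) (by grind) (by grind)
  have cA : (∀ x ∈ A, x = a) → H.IsCubicAt a := fun h ↦ ⟨b, c, v, fun u hu ↦ by
    rcases eA a ha u hu with i | i | i | i
    · exact absurd (h u i).symm hu.ne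
    · exact .inr (.inl i)
    · exact .inr (.inr i)
    · exact .inl i.2⟩
  have cB : (∀ x ∈ B, x = b) → H.IsCubicAt b := fun h ↦ ⟨a, c, v, fun u hu ↦ by
    rcases eB b hb u hu with i | i | i | i
    · exact absurd (h u i).symm hu.ne
    · exact .inr (.inl i)
    · exact .inr (.inr i)
    · exact .inl i.1⟩
  have cB' : (∀ x ∈ B', x = b) → H.IsCubicAt b := fun h ↦ ⟨a, c, w, fun u hu ↦ by
    rcases eB' b hb' u hu with i | i | i | i
    · exact absurd (h u i).symm hu.ne
    · exact .inl i
    · exact .inr (.inr i)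
    · exact .inr (.inl i.2)⟩
  clear eA eB eC eB' e₁ e₂
  have kB (h₂ : v = w ∨ v ∈ B' ∨ w ∈ A) (h₃ : v = w ∨ v ∈ C' ∨ w ∈ A) (h : w ∉ B) :
      H.IsCubicAt b := by
    refine cB fun x hx ↦ ?_
    rcases k₂ x with i | i | rfl | rfl
    · by_contra hxb
      exact q₃ h₃ x ⟨⟨hx, i⟩, hxb⟩
    · exact absurd ⟨hx, i⟩ (q₂ h₂ x)
    · exact absurd hx (d₁ _ ha)
    · contradiction
  -- In each possible position of `v` and `w`, enough corners vanish to reduce `A` to `{a}`, or `B`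
  -- or `B'` to `{b}`.
  rcases k₁ w with hw | hw | rfl | rfl
  · exact .inr (kB (.inr (.inr hw)) (.inr (.inr hw)) (d₁ w hw))
  · rcases k₂ v with hv | hv | rfl | rfl
    · refine .inl (cA fun x hx ↦ ?_)
      rcases k₂ x with h | h | rfl | rfl
      · exact absurd ⟨hx, h⟩ (q₁ (.inr (.inr hw)) x)
      · exact absurd ⟨hx, h⟩ (q₄ hv hw x)
      · rfl
      · exact absurd hw (d₁ _ hx)
    · refine .inr (cB' fun x hx ↦ ?_)
      rcases k₁ x with h | h | rfl | rfl
      · exact absurd ⟨h, hx⟩ (q₁ (.inr (.inl hv)) x)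
      · by_contra hxb
        exact q₃ (.inr (.inl hv)) x ⟨⟨h, hx⟩, hxb⟩
      · exact absurd hc' (d₂ _ hx)
      · exact absurd hv (d₂ _ hx)
    · exact absurd rfl (l₁ _ ha).2
    · exact absurd rfl (r₁ _ hw).2
  · exact absurd rfl (r₂ _ hc').2
  · exact .inr (kB (.inl rfl) (.inl rfl) fun h ↦ (r₁ _ h).2 rfl)

set_option maxHeartbeats 1000000 in
/-- Uncrossing the separations belonging to two uncontractible edges at a cubic vertex `v`
with neighbours `x`, `y`, `z`. -/
lemma NoSmallCut.false_of_uncross (hP : H.NoSmallCut) {v x y z w u : V} {S T S' T' : Set V}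
    (hN : ∀ t, H.Adj v t → t = x ∨ t = y ∨ t = z)
    (hd : ∀ a p q, ∃ b, H.Adj a b ∧ b ≠ p ∧ b ≠ q)
    (nxy : ¬ H.Adj x y) (nxz : ¬ H.Adj x z) (nyz : ¬ H.Adj y z)
    (hyS : y ∈ S) (hzT : z ∈ T) (hxS : x ∈ S') (hzT' : z ∈ T') (hwv : w ≠ v) (huv : u ≠ v)
    (h₁ : H.IsSeparation {v, x, w} S T) (h₂ : H.IsSeparation {v, y, u} S' T') : False := by
  obtain ⟨⟨-, -, k₁, d₁, l₁, r₁⟩, e₁⟩ := h₁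
  obtain ⟨⟨-, -, k₂, d₂, l₂, r₂⟩, e₂⟩ := h₂
  simp only [Set.mem_insert_iff, Set.mem_singleton_iff, not_or] at k₁ l₁ r₁ k₂ l₂ r₂
  -- Each side contains exactly one of the neighbours of `v`, so `v` is an outside neighbour of that
  -- one vertex only.
  have eS : ∀ s ∈ S, ∀ t, H.Adj s t → t ∈ S ∨ t = x ∨ t = w ∨ (t = v ∧ s = y) := by
    intro s hs t ht
    have := k₁ t
    have := hN s
    grind [H.adj_comm]
  have eT : ∀ s ∈ T, ∀ t, H.Adj s t → t ∈ T ∨ t = x ∨ t = w ∨ (t = v ∧ s = z) := by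
    intro s hs t ht
    have := k₁ t
    have := hN s
    have := e₁ t
    grind [H.adj_comm]
  have eS' : ∀ s ∈ S', ∀ t, H.Adj s t → t ∈ S' ∨ t = y ∨ t = u ∨ (t = v ∧ s = x) := by
    intro s hs t ht
    have := k₂ t
    have := hN s
    grind [H.adj_comm]
  have eT' : ∀ s ∈ T', ∀ t, H.Adj s t → t ∈ T' ∨ t = y ∨ t = u ∨ (t = v ∧ s = z) := by
    intro s hs t ht
    have := k₂ t
    have := hN s
    have := e₂ t
    grind [H.adj_comm]
  have q₁ : w = u ∨ w ∈ S' ∨ u ∈ T → ∀ t, t ∉ S ∩ T' := by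
    intro h
    rcases h with h | h | h
    · exact hP _ y u (fun s hs t ht ↦ by
        have i₁ := eS s hs.1 t ht
        have i₂ := eT' s hs.2 t ht
        clear eS eT eS' eT' e₁ e₂ hP hN
        grind) z (by grind) (by grind) (by grind)
    · exact hP _ y u (fun s hs t ht ↦ by
        have i₁ := eS s hs.1 t ht
        have i₂ := eT' s hs.2 t ht
        clear eS eT eS' eT' e₁ e₂ hP hN
        grind) z (by grind) (by grind) (by grind)
    · exact hP _ y w (fun s hs t ht ↦ by
        have i₁ := eS s hs.1 t ht
        have i₂ := eT' s hs.2 t ht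
        clear eS eT eS' eT' e₁ e₂ hP hN
        grind) z (by grind) (by grind) (by grind)
  have q₂ : w = u ∨ w ∈ T' ∨ u ∈ S → ∀ t, t ∉ T ∩ S' := by
    intro h
    rcases h with h | h | h
    · exact hP _ x u (fun s hs t ht ↦ by
        have i₁ := eT s hs.1 t ht
        have i₂ := eS' s hs.2 t ht
        clear eS eT eS' eT' e₁ e₂ hP hN
        grind) z (by grind) (by grind) (by grind)
    · exact hP _ x u (fun s hs t ht ↦ by
        have i₁ := eT s hs.1 t ht
        have i₂ := eS' s hs.2 t ht
        clear eS eT eS' eT' e₁ e₂ hP hN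
        grind) z (by grind) (by grind) (by grind)
    · exact hP _ x w (fun s hs t ht ↦ by
        have i₁ := eT s hs.1 t ht
        have i₂ := eS' s hs.2 t ht
        clear eS eT eS' eT' e₁ e₂ hP hN
        grind) z (by grind) (by grind) (by grind)
  have q₃ : w = u ∨ w ∈ S' ∨ u ∈ S → ∀ t, t ∉ (T ∩ T') \ {z} := by
    intro h
    rcases h with h | h | h
    · exact hP _ z u (fun s hs t ht ↦ by
        have i₁ := eT s hs.1.1 t ht
        have i₂ := eT' s hs.1.2 t ht
        clear eS eT eS' eT' e₁ e₂ hP hN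
        grind) x (by grind) (by grind) (by grind)
    · exact hP _ z u (fun s hs t ht ↦ by
        have i₁ := eT s hs.1.1 t ht
        have i₂ := eT' s hs.1.2 t ht
        clear eS eT eS' eT' e₁ e₂ hP hN
        grind) x (by grind) (by grind) (by grind)
    · exact hP _ z w (fun s hs t ht ↦ by
        have i₁ := eT s hs.1.1 t ht
        have i₂ := eT' s hs.1.2 t ht
        clear eS eT eS' eT' e₁ e₂ hP hN
        grind) y (by grind) (by grind) (by grind)
  have q₄ : w ∈ T' → u ∈ T → ∀ t, t ∉ S ∩ S' := by
    intro h h'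
    exact hP _ x y (fun s hs t ht ↦ by
        have i₁ := eS s hs.1 t ht
        have i₂ := eS' s hs.2 t ht
        clear eS eT eS' eT' e₁ e₂ hP hN
        grind) z (by grind) (by grind) (by grind)
  -- A side reduced to one vertex would leave that vertex with at most two neighbours, since `x`,
  -- `y`, `z` are pairwise nonadjacent.
  have cT : ¬ ∀ t ∈ T, t = z := by
    intro h
    obtain ⟨b, hb, h1, h2⟩ := hd z v w
    rcases eT z hzT b hb with h3 | rfl | h3 | h3
    · exact hb.ne (h b h3).symm
    · exact nxz hb.symm
    · exact h2 h3
    · exact h1 h3.1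
  have cT' : ¬ ∀ t ∈ T', t = z := by
    intro h
    obtain ⟨b, hb, h1, h2⟩ := hd z v u
    rcases eT' z hzT' b hb with h3 | rfl | h3 | h3
    · exact hb.ne (h b h3).symm
    · exact nyz hb.symm
    · exact h2 h3
    · exact h1 h3.1
  have cS' : ¬ ∀ t ∈ S', t = x := by
    intro h
    obtain ⟨b, hb, h1, h2⟩ := hd x v u
    rcases eS' x hxS b hb with h3 | rfl | h3 | h3
    · exact hb.ne (h b h3).symm
    · exact nxy hb
    · exact h2 h3
    · exact h1 h3.1
  have hw := k₂ w
  have hu := k₁ u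
  simp only [Set.mem_inter_iff, Set.mem_sdiff, Set.mem_singleton_iff] at q₁ q₂ q₃ q₄
  clear eS eT eS' eT' e₁ e₂ hN
  by_cases hwu : w = u
  · apply cT; grind
  rcases hw with hw | hw | hw
  · apply cT'; grind
  · rcases hu with hu | hu | hu
    · apply cT; grind
    · apply cS'; grind
    · grind
  · grind

/-! ### Triangles and cubic vertices -/

/-- Deleting the edge `ab` leaves a graph in which at most two vertices separate `a` from `b`. -/
def IsUndeletable (H : SimpleGraph V) (a b : V) : Prop :=
  ∃ X S T : Set V, X.encard ≤ 2 ∧ IsTripartition X S T ∧ a ∈ S ∧ b ∈ T ∧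
    ∀ s ∈ S, ∀ t ∈ T, H.Adj s t → s = a ∧ t = b

/-- The vertices `x` and `y` have a common neighbour or lie in a separating set of size three. -/
def IsUncontractible (H : SimpleGraph V) (x y : V) : Prop :=
  (∃ z, H.Adj x z ∧ H.Adj y z) ∨ ∃ w S T, H.IsSeparation {x, y, w} S T

lemma exists_eq_pair_of_encard_le_two {X : Set V} (hX : X.encard ≤ 2) {c : V} (hc : c ∈ X) :
    ∃ v, X = {c, v} := by
  rw [← Set.encard_sdiff_singleton_add_one hc, show (2 : ℕ∞) = 1 + 1 by norm_num,
    ENat.add_le_add_iff_right ENat.one_ne_top] at hX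
  rcases Set.encard_le_one_iff_eq.1 hX with h | ⟨v, h⟩
  · exact ⟨c, by rw [Set.pair_eq_singleton, ← Set.insert_sdiff_self_of_mem hc, h]; simp⟩
  · exact ⟨v, by rw [← h, Set.insert_sdiff_self_of_mem hc]⟩

/-- The path `a c b` survives the deletion of `ab`, so the separator must contain `c`. The case `v =
c` is allowed. -/
lemma IsUndeletable.exists_pair {a b c : V} (h : H.IsUndeletable a b) (hac : H.Adj a c)
    (hcb : H.Adj c b) : ∃ v S T, IsTripartition {c, v} S T ∧ a ∈ S ∧ b ∈ T ∧
      ∀ s ∈ S, ∀ t ∈ T, H.Adj s t → s = a ∧ t = b := by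
  obtain ⟨X, S, T, hX, hp, ha, hb, he⟩ := h
  have hc : c ∈ X := by
    rcases hp.cover c with h | h | h
    · exact absurd (he c h b hb hcb).1.symm hac.ne
    · exact absurd (he a ha c h hac).2 hcb.ne
    · exact h
  obtain ⟨v, rfl⟩ := exists_eq_pair_of_encard_le_two hX hc
  exact ⟨v, S, T, hp, ha, hb, he⟩

/-- In a triangle of undeletable edges, every edge has a cubic end. -/
lemma NoSmallCut.isCubicAt_or_of_triangle (hP : H.NoSmallCut)
    (hdel : ∀ a b, H.Adj a b → H.IsUndeletable a b) {a b c : V} (hab : H.Adj a b)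
    (hbc : H.Adj b c) (hac : H.Adj a c) : H.IsCubicAt a ∨ H.IsCubicAt b := by
  obtain ⟨v, A, B, h₁, ha, hb, e₁⟩ := (hdel a b hab).exists_pair hac hbc.symm
  obtain ⟨w, B', C', h₂, hb', hc', e₂⟩ := (hdel b c hbc).exists_pair hab.symm hac
  exact hP.isCubicAt_or_of_uncross ha hb hb' hc' h₁ h₂ e₁ e₂

/-- Otherwise `p` and `q` cut off `{a}`. This is minimum degree three, which turns the upper bound
in `IsCubicAt` into equality. -/
lemma NoSmallCut.exists_adj_ne (hP : H.NoSmallCut)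
    (hcard : ∀ p q r : V, ∃ x, x ≠ p ∧ x ≠ q ∧ x ≠ r) (a p q : V) :
    ∃ b, H.Adj a b ∧ b ≠ p ∧ b ≠ q := by
  by_contra! h
  obtain ⟨c, h1, h2, h3⟩ := hcard a p q
  exact hP {a} p q (by grind) c (by simpa) h2 h3 a rfl

/-- If `p` had no neighbour in `S`, then `q` and `r` alone would cut off `S`. -/
lemma NoSmallCut.exists_adj_left (hP : H.NoSmallCut) {p q r : V} {S T : Set V}
    (h : H.IsSeparation {p, q, r} S T) : ∃ s ∈ S, H.Adj p s := by
  by_contra! hn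
  obtain ⟨x, hx⟩ := h.left_nonempty
  obtain ⟨t, ht⟩ := h.right_nonempty
  have hr := h.right_disj t ht
  refine hP S q r (fun a ha b hab ↦ ?_) t (fun h' ↦ h.disj t h' ht) (by grind) (by grind) x hx
  rcases h.cover b with hb | hb | rfl | hb | hb
  · exact .inl hb
  · exact absurd hab (h.not_adj a ha b hb)
  · exact absurd hab.symm (hn a ha)
  · exact .inr (.inl hb)
  · exact .inr (.inr hb)

lemma NoSmallCut.exists_adj_right (hP : H.NoSmallCut) {p q r : V} {S T : Set V}
    (h : H.IsSeparation {p, q, r} S T) : ∃ t ∈ T, H.Adj p t :=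
  hP.exists_adj_left h.symm

/-- Excludes the degenerate separator with only two distinct vertices. -/
lemma NoSmallCut.ne_of_isSeparation (hP : H.NoSmallCut) {p q r : V} {S T : Set V}
    (h : H.IsSeparation {p, q, r} S T) : r ≠ p := by
  rintro rfl
  obtain ⟨s, hs, hqs⟩ := hP.exists_adj_left h
  obtain ⟨t, ht⟩ := h.right_nonempty
  have hr := h.right_disj t ht
  refine hP S r q (fun a ha b hab ↦ ?_) t (fun h' ↦ h.disj t h' ht) (by grind) (by grind) s hs
  rcases h.cover b with hb | hb | hb | hb | hb
  · exact .inl hb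
  · exact absurd hab (h.not_adj a ha b hb)
  · exact .inr (.inl hb)
  · exact .inr (.inr hb)
  · exact .inr (.inl hb)

/-- If no triangle contains the edge `vx` at a cubic vertex `v` with neighbours `x`, `y`, `z`,
then `v` and `x` extend to a separation with `y` and `z` on different sides. -/
lemma NoSmallCut.exists_isSeparation_of_cubic (hP : H.NoSmallCut) {v x y z : V}
    (hcon : H.IsUncontractible v x) (hN : ∀ t, H.Adj v t → t = x ∨ t = y ∨ t = z)
    (nxy : ¬ H.Adj x y) (nxz : ¬ H.Adj x z) :
    ∃ w S T, H.IsSeparation {v, x, w} S T ∧ w ≠ v ∧ y ∈ S ∧ z ∈ T := by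
  rcases hcon with ⟨t, hvt, hxt⟩ | ⟨w, S, T, h⟩
  · rcases hN t hvt with rfl | rfl | rfl
    · exact absurd rfl hxt.ne
    · contradiction
    · contradiction
  · have hw := hP.ne_of_isSeparation h
    obtain ⟨s, hs, hvs⟩ := hP.exists_adj_left h
    obtain ⟨t, ht, hvt⟩ := hP.exists_adj_right h
    have h1 := h.left_disj s hs
    have h2 := h.right_disj t ht
    have h3 := h.disj s hs
    rcases hN s hvs with rfl | rfl | rfl
    · simp at h1
    · rcases hN t hvt with rfl | rfl | rfl
      · simp at h2
      · contradiction
      · exact ⟨w, S, T, h, hw, hs, ht⟩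
    · rcases hN t hvt with rfl | rfl | rfl
      · simp at h2
      · exact ⟨w, T, S, h.symm, hw, ht, hs⟩
      · contradiction

/-- Every edge at a cubic vertex lies in a triangle if no edge is contractible. -/
lemma NoSmallCut.adj_or_adj_of_cubic (hP : H.NoSmallCut)
    (hcard : ∀ p q r : V, ∃ x, x ≠ p ∧ x ≠ q ∧ x ≠ r)
    (hcon : ∀ a b, H.Adj a b → H.IsUncontractible a b) {v x y z : V}
    (hN : ∀ t, H.Adj v t → t = x ∨ t = y ∨ t = z) : H.Adj x y ∨ H.Adj x z := by
  by_contra! ⟨nxy, nxz⟩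
  have hvx : H.Adj v x := by
    obtain ⟨b, hb, h1, h2⟩ := hP.exists_adj_ne hcard v y z
    grind
  have hvy : H.Adj v y := by
    obtain ⟨b, hb, h1, h2⟩ := hP.exists_adj_ne hcard v x z
    grind
  obtain ⟨w, S, T, h₁, hw, hy, hz⟩ :=
    hP.exists_isSeparation_of_cubic (hcon v x hvx) hN nxy nxz
  have nyz := h₁.not_adj y hy z hz
  obtain ⟨u, S', T', h₂, hu, hx, hz'⟩ :=
    hP.exists_isSeparation_of_cubic (x := y) (y := x) (z := z) (hcon v y hvy) (by grind)
      (fun h ↦ nxy h.symm) nyz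
  exact hP.false_of_uncross hN (hP.exists_adj_ne hcard) nxy nxz nyz hy hz hx hz' hw hu h₁ h₂

/-- The new side is `S ∩ T'`. It is smaller because it misses `v`. It is nonempty because `v` has a
neighbour in `T'`, which must lie in `S`: it is not in `T`, and `T'` misses `x`, `y` and `w`. -/
lemma NoSmallCut.exists_smaller_separation [Finite V] (hP : H.NoSmallCut)
    {x y w v u : V} {S T S' T' : Set V} (hv : v ∈ S)
    (h : H.IsSeparation {x, y, w} S T) (h' : H.IsSeparation {w, v, u} S' T')
    (hx : x ∉ T') (hy : y ∉ T') :
    ∃ S'' T'', H.IsSeparation {w, v, u} S'' T'' ∧ S''.ncard < S.ncard := by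
  have hv' : v ∉ T' := fun hvT ↦ h'.right_disj v hvT (by simp)
  have hw' : w ∉ T' := fun hvT ↦ h'.right_disj w hvT (by simp)
  obtain ⟨t, ht, hvt⟩ := hP.exists_adj_right (p := v) (q := w) (r := u) (by
    rwa [Set.insert_comm] at h')
  have key : ∀ s ∈ S ∩ T', ∀ b, H.Adj s b → b ∈ S ∩ T' ∨ b ∈ ({w, v, u} : Set V) := by
    rintro s ⟨hs, hs'⟩ b hsb
    rcases h'.cover b with hb | hb | hb
    · exact absurd hsb.symm (h'.not_adj b hb s hs')
    · rcases h.cover b with hb' | hb' | hb'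
      · exact .inl ⟨hb', hb⟩
      · exact absurd hsb (h.not_adj s hs b hb')
      · grind
    · exact .inr hb
  have htS : t ∈ S := by
    rcases h.cover t with hb | hb | hb
    · exact hb
    · exact absurd hvt (h.not_adj v hv t hb)
    · grind
  refine ⟨S ∩ T', {b | b ∉ S ∩ T' ∧ b ∉ ({w, v, u} : Set V)},
    ⟨⟨⟨t, htS, ht⟩, ?_, ?_, ?_, ?_, ?_⟩, ?_⟩, ?_⟩
  · obtain ⟨s, hs⟩ := h'.left_nonempty
    exact ⟨s, fun hb ↦ h'.disj s hs hb.2, h'.left_disj s hs⟩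
  · intro b
    by_cases h1 : b ∈ S ∩ T'
    · exact .inl h1
    · by_cases h2 : b ∈ ({w, v, u} : Set V)
      · exact .inr (.inr h2)
      · exact .inr (.inl ⟨h1, h2⟩)
  · exact fun b hb hb' ↦ hb'.1 hb
  · exact fun b hb ↦ h'.right_disj b hb.2
  · exact fun b hb ↦ hb.2
  · intro s hs b hb hsb
    rcases key s hs b hsb with h1 | h1
    · exact hb.1 h1
    · exact hb.2 h1
  · refine Set.ncard_lt_ncard ⟨Set.inter_subset_left, fun hsub ↦ hv' (hsub hv).2⟩ (Set.toFinite _)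

/-- A graph without contractible edges has a triangle. -/
lemma NoSmallCut.exists_triangle [Finite V] (hP : H.NoSmallCut)
    (hcard : ∀ p q r : V, ∃ x, x ≠ p ∧ x ≠ q ∧ x ≠ r) [Nonempty V]
    (hcon : ∀ a b, H.Adj a b → H.IsUncontractible a b) :
    ∃ a b c, H.Adj a b ∧ H.Adj b c ∧ H.Adj a c := by
  by_contra! hno
  have hsep : ∀ a b, H.Adj a b → ∃ w S T, H.IsSeparation {a, b, w} S T := fun a b hab ↦
    (hcon a b hab).resolve_left fun ⟨z, hz⟩ ↦ hno a b z hab hz.2 hz.1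
  have main : ∀ n : ℕ, ∀ x y w S T, H.Adj x y → H.IsSeparation {x, y, w} S T →
      S.ncard ≠ n := by
    intro n
    induction n using Nat.strong_induction_on with
    | _ n ih =>
      rintro x y w S T hxy h rfl
      obtain ⟨v, hv, hwv⟩ := hP.exists_adj_left (p := w) (q := x) (r := y) (by
        rwa [show ({x, y, w} : Set V) = {w, x, y} by grind] at h)
      obtain ⟨u, S', T', h'⟩ := hsep w v hwv
      -- The adjacent vertices `x` and `y` cannot lie on opposite sides, so some side contains
      -- neither.
      have hside : (x ∉ T' ∧ y ∉ T') ∨ (x ∉ S' ∧ y ∉ S') := by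
        have h1 := h'.not_adj x
        have h2 := h'.not_adj y
        have h3 := h'.disj x
        have h4 := h'.disj y
        have h5 := hxy.symm
        grind
      rcases hside with ⟨hx, hy⟩ | ⟨hx, hy⟩
      · obtain ⟨S'', T'', h'', hlt⟩ := hP.exists_smaller_separation hv h h' hx hy
        exact ih _ hlt w v u S'' T'' hwv h'' rfl
      · obtain ⟨S'', T'', h'', hlt⟩ := hP.exists_smaller_separation hv h h'.symm hx hy
        exact ih _ hlt w v u S'' T'' hwv h'' rfl
  obtain ⟨x⟩ := ‹Nonempty V›
  obtain ⟨y, hxy, -⟩ := hP.exists_adj_ne hcard x x x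
  obtain ⟨w, S, T, h⟩ := hsep x y hxy
  exact main _ x y w S T hxy h rfl

/-! ### Finding the hub -/

/-- A noncubic neighbour `y` of a cubic vertex is adjacent to all other vertices, and they are
all cubic. -/
lemma NoSmallCut.isHub_of_not_isCubicAt (hP : H.NoSmallCut)
    (hcard : ∀ p q r : V, ∃ x, x ≠ p ∧ x ≠ q ∧ x ≠ r)
    (hdel : ∀ a b, H.Adj a b → H.IsUndeletable a b)
    (hcon : ∀ a b, H.Adj a b → H.IsUncontractible a b) {y d : V} (hy : ¬ H.IsCubicAt y)
    (hd : H.IsCubicAt d) (hyd : H.Adj y d) (u : V) (huy : u ≠ y) :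
    H.Adj y u ∧ H.IsCubicAt u := by
  by_contra hu
  -- If `y` were not adjacent to `p`, the triangles at `d` would give the edges `pq` and `yq`. Then
  -- `q` is cubic by the triangle `yqd`, and `y`, `p` cut off `{d, q}` from a fourth neighbour of
  -- the noncubic `y`.
  have step : ∀ d p q, H.IsCubicAt d → H.Adj y d →
      (∀ t, H.Adj d t → t = y ∨ t = p ∨ t = q) → H.Adj y p := by
    intro d p q hd hyd hN
    by_contra hyp
    have hpq : H.Adj p q := by
      have := hP.adj_or_adj_of_cubic hcard hcon (v := d) (x := p) (y := y) (z := q) (by grind)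
      exact this.resolve_left fun h ↦ hyp h.symm
    have hyq : H.Adj y q := (hP.adj_or_adj_of_cubic hcard hcon hN).resolve_left hyp
    have hdp : H.Adj d p := by
      obtain ⟨b, hb, h1, h2⟩ := hP.exists_adj_ne hcard d y q
      grind
    have hdq : H.Adj d q := by
      obtain ⟨b, hb, h1, h2⟩ := hP.exists_adj_ne hcard d y p
      grind
    obtain ⟨a, b, c, hq⟩ := (hP.isCubicAt_or_of_triangle hdel hyq hdq.symm hyd).resolve_left hy
    have hNq : ∀ t, H.Adj q t → t = d ∨ t = p ∨ t = y := by
      have h1 := hq d hdq.symm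
      have h2 := hq p hpq.symm
      have h3 := hq y hyq.symm
      have h4 := hyd.ne
      have h5 := hdp.ne
      have h6 : y ≠ p := by
        rintro rfl
        obtain ⟨b, hb, h1, h2⟩ := hP.exists_adj_ne hcard d y q
        grind
      intro t ht
      have h7 := hq t ht
      clear hP hdel hcon hcard
      grind
    have : ∃ c, H.Adj y c ∧ c ≠ d ∧ c ≠ p ∧ c ≠ q := by
      by_contra! hn
      exact hy ⟨d, p, q, fun u hu ↦ by
        by_contra! hh
        exact hh.2.2 (hn u hu hh.1 hh.2.1)⟩
    obtain ⟨c, hyc, hcd, hcp, hcq⟩ := this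
    exact hP {d, q} y p (by grind) c (by grind) hyc.ne.symm hcp d (by simp)
  -- The repeated `y` expresses a cut by a single vertex.
  refine hP {d | H.Adj y d ∧ H.IsCubicAt d} y y ?_ u hu huy huy d ⟨hyd, hd⟩
  rintro a ⟨hya, ha⟩ b hab
  by_cases hby : b = y
  · exact .inr (.inl hby)
  left
  have hyb : H.Adj y b := by
    obtain ⟨p, q, r, hN⟩ := ha
    have ha : H.IsCubicAt a := ⟨p, q, r, hN⟩
    rcases hN y hya.symm with rfl | rfl | rfl
    · rcases hN b hab with rfl | rfl | rfl
      · contradiction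
      · exact step a b r ha hya hN
      · exact step a b q ha hya (by grind)
    · rcases hN b hab with rfl | rfl | rfl
      · exact step a b r ha hya (by grind)
      · contradiction
      · exact step a b p ha hya (by grind)
    · rcases hN b hab with rfl | rfl | rfl
      · exact step a b q ha hya (by grind)
      · exact step a b p ha hya (by grind)
      · contradiction
  exact ⟨hyb, (hP.isCubicAt_or_of_triangle hdel hyb hab.symm hya).resolve_left hy⟩

/-- If all vertices are cubic, then some vertex is adjacent to all others. -/
lemma NoSmallCut.exists_hub_of_forall_isCubicAt (hP : H.NoSmallCut)
    (hcard : ∀ p q r : V, ∃ x, x ≠ p ∧ x ≠ q ∧ x ≠ r)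
    (hcon : ∀ a b, H.Adj a b → H.IsUncontractible a b) [Nonempty V]
    (hc : ∀ v, H.IsCubicAt v) : ∃ y, ∀ u, u ≠ y → H.Adj y u := by
  -- When `xyz` is a path in the neighbourhood of `v`, both `v` and `y` have their remaining
  -- neighbours in `{x, z}`, so a vertex not adjacent to `v` would be cut off by `x` and `z`.
  have aux : ∀ v x y z, (∀ t, H.Adj v t → t = x ∨ t = y ∨ t = z) → H.Adj x y → H.Adj y z →
      ∀ u, u ≠ v → H.Adj v u := by
    intro v x y z hN hxy hyz u hu
    have hvx : H.Adj v x := by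
      obtain ⟨b, hb, h1, h2⟩ := hP.exists_adj_ne hcard v y z
      grind
    have hvy : H.Adj v y := by
      obtain ⟨b, hb, h1, h2⟩ := hP.exists_adj_ne hcard v x z
      grind
    have hvz : H.Adj v z := by
      obtain ⟨b, hb, h1, h2⟩ := hP.exists_adj_ne hcard v x y
      grind
    have hxz : x ≠ z := by
      rintro rfl
      obtain ⟨b, hb, h1, h2⟩ := hP.exists_adj_ne hcard v x y
      grind
    by_contra hvu
    obtain ⟨p, q, r, hy⟩ := hc y
    have hNy : ∀ t, H.Adj y t → t = v ∨ t = x ∨ t = z := by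
      have h1 := hy v hvy.symm
      have h2 := hy x hxy.symm
      have h3 := hy z hyz
      have h4 := hvx.ne
      have h5 := hvz.ne
      intro t ht
      have h7 := hy t ht
      clear hP hcon hcard hc
      grind
    refine hP {v, y} x z ?_ u (by grind) (by grind) (by grind) v (by simp)
    grind
  obtain ⟨v⟩ := ‹Nonempty V›
  obtain ⟨x, y, z, hN⟩ := hc v
  have h1 := hP.adj_or_adj_of_cubic hcard hcon hN
  have h2 := hP.adj_or_adj_of_cubic hcard hcon (v := v) (x := y) (y := x) (z := z) (by grind)
  have h3 := hP.adj_or_adj_of_cubic hcard hcon (v := v) (x := z) (y := x) (z := y) (by grind)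
  refine ⟨v, ?_⟩
  -- Each of `x`, `y`, `z` is adjacent to another of them, so at least two of the three possible
  -- edges are present and form a path.
  by_cases hxy : H.Adj x y
  · by_cases hyz : H.Adj y z
    · exact aux v x y z hN hxy hyz
    · exact aux v y x z (by grind) hxy.symm (h3.resolve_right fun h ↦ hyz h.symm).symm
  · exact aux v x z y (by grind) (h1.resolve_left hxy)
      (h2.resolve_left fun h ↦ hxy h.symm).symm

/-- The structure of a graph without small cuts all of whose edges are essential. -/
theorem NoSmallCut.exists_hub [Finite V] [Nonempty V] (hP : H.NoSmallCut)
    (hcard : ∀ p q r : V, ∃ x, x ≠ p ∧ x ≠ q ∧ x ≠ r)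
    (hdel : ∀ a b, H.Adj a b → H.IsUndeletable a b)
    (hcon : ∀ a b, H.Adj a b → H.IsUncontractible a b) :
    ∃ y, ∀ u, u ≠ y → H.Adj y u ∧ H.IsCubicAt u := by
  by_cases h : ∃ y d, ¬ H.IsCubicAt y ∧ H.IsCubicAt d ∧ H.Adj y d
  · obtain ⟨y, d, hy, hd, hyd⟩ := h
    exact ⟨y, hP.isHub_of_not_isCubicAt hcard hdel hcon hy hd hyd⟩
  · push Not at h
    obtain ⟨a, b, c, hab, hbc, hac⟩ := hP.exists_triangle hcard hcon
    have hd : ∃ d, H.IsCubicAt d := by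
      rcases hP.isCubicAt_or_of_triangle hdel hab hbc hac with h | h
      exacts [⟨a, h⟩, ⟨b, h⟩]
    obtain ⟨d, hd⟩ := hd
    have hall : ∀ v, H.IsCubicAt v := by
      intro v
      by_contra hv
      have hvd : v ≠ d := by rintro rfl; exact hv hd
      refine hP {v | H.IsCubicAt v} d d (fun a ha b hab ↦ ?_) v hv hvd hvd d hd
      left
      by_contra hb
      exact h b a hb ha hab.symm
    obtain ⟨y, hy⟩ := hP.exists_hub_of_forall_isCubicAt hcard hcon hall
    exact ⟨y, fun u hu ↦ ⟨hy u hu, hall u⟩⟩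

/-! ### From a hub to a wheel -/

lemma ncard_neighborSet_cycleGraph {n : ℕ} (hn : 3 ≤ n) (a : Fin n) :
    ((cycleGraph n).neighborSet a).ncard = 2 := by
  obtain ⟨m, rfl⟩ := Nat.exists_eq_add_of_le' hn
  rw [← cycleGraph_degree_three_le (v := a), ← card_neighborSet_eq_degree,
    ← Nat.card_eq_fintype_card]
  rfl

/-- A finite connected 2-regular graph is a cycle. -/
theorem Connected.exists_iso_cycleGraph {W : Type*} [Finite W] {R : SimpleGraph W}
    (hR : R.Connected) (h2 : ∀ v, (R.neighborSet v).ncard = 2) :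
    ∃ n, 3 ≤ n ∧ Nonempty (R ≃g cycleGraph n) := by
  classical
  have := Fintype.ofFinite W
  obtain ⟨v⟩ := hR.nonempty
  have hcyc : R.IsCycles := fun v _ ↦ h2 v
  obtain ⟨p, hp, hsupp⟩ := hcyc.exists_cycle_toSubgraph_verts_eq_connectedComponentSupp
    (c := R.connectedComponentMk v) (v := v) rfl
    (Set.nonempty_of_ncard_ne_zero (by rw [h2]; norm_num))
  have hall : ∀ w, w ∈ p.support := by
    intro w
    rw [← Walk.mem_verts_toSubgraph, hsupp, ConnectedComponent.mem_supp_iff,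
      ConnectedComponent.eq]
    exact hR.preconnected w v
  have hham : p.IsHamiltonianCycle := by
    rw [Walk.isHamiltonianCycle_iff_isCycle_and_support_count_tail_eq_one]
    refine ⟨hp, fun a ↦ List.count_eq_one_of_mem hp.support_nodup ?_⟩
    have ha := hall a
    rw [← Walk.cons_tail_support, List.mem_cons] at ha
    rcases ha with rfl | ha
    · exact Walk.end_mem_tail_support hp.not_nil
    · exact ha
  have hlen := hham.length_eq
  have h3 := hp.three_le_length
  obtain ⟨f⟩ := (cycleGraph_isContained_iff (G := R) (n := p.length) h3).2 ⟨v, p, hp, rfl⟩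
  refine ⟨p.length, h3, ⟨Iso.symm ⟨Equiv.ofBijective f ?_, ?_⟩⟩⟩
  · exact (Fintype.bijective_iff_injective_and_card f).2 ⟨f.injective, by simp [hlen]⟩
  · intro a b
    refine ⟨fun hab ↦ ?_, fun hab ↦ f.toHom.map_adj hab⟩
    have hinj : Function.Injective f := f.injective
    -- The Hamiltonian cycle gives a bijective homomorphism. It reflects adjacency because
    -- corresponding neighbourhoods both have two elements.
    have key : f '' (cycleGraph p.length).neighborSet a = R.neighborSet (f a) := by
      refine Set.eq_of_subset_of_ncard_le ?_ ?_ (Set.toFinite _)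
      · rintro _ ⟨c, hc, rfl⟩
        exact f.toHom.map_adj hc
      · rw [h2, Set.ncard_image_of_injective _ hinj]
        exact (ncard_neighborSet_cycleGraph h3 a).ge
    have hmem : f b ∈ R.neighborSet (f a) := hab
    rw [← key] at hmem
    obtain ⟨c, hc, hcb⟩ := hmem
    rwa [← f.injective hcb]

lemma nonempty_iso_wheelGraph {y : V} (hy : ∀ u, u ≠ y → H.Adj y u) {n : ℕ}
    (f : H.induce {u | u ≠ y} ≃g cycleGraph n) : Nonempty (H ≃g Graph.wheelGraph n) := by
  classical
  let g : Option (Fin n) ≃ V :=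
    (Equiv.optionCongr f.toEquiv.symm).trans (Equiv.optionSubtypeNe y)
  have g_none : g none = y := by
    change Equiv.optionSubtypeNe y none = _
    simp
  have g_some (i : Fin n) : g (some i) = f.symm i := by
    change Equiv.optionSubtypeNe y (some (f.symm i)) = _
    simp
  refine ⟨Iso.symm ⟨g, ?_⟩⟩
  rintro (_ | a) (_ | b)
  · simp
  · simpa [Graph.wheelGraph, g_none, g_some] using hy _ (f.symm b).2
  · simpa [Graph.wheelGraph, g_none, g_some] using (hy _ (f.symm a).2).symm
  · have := f.symm.map_adj_iff (v := a) (w := b)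
    rw [g_some, g_some]
    simp only [comap_adj, Function.Embedding.subtype_apply] at this
    rw [this]
    simp only [Graph.wheelGraph, sup_adj, starGraph_adj, reduceCtorEq, or_self, and_false, or_false]
    exact (map_adj_apply (f := Function.Embedding.some)).symm

/-- One vertex does not disconnect the graph, and every other vertex loses exactly one of its three
neighbours when the hub `y` is deleted. -/
lemma NoSmallCut.exists_iso_wheelGraph [Finite V] (hP : H.NoSmallCut)
    (hcard : ∀ p q r : V, ∃ x, x ≠ p ∧ x ≠ q ∧ x ≠ r) {y : V}
    (hy : ∀ u, u ≠ y → H.Adj y u ∧ H.IsCubicAt u) :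
    ∃ n, 3 ≤ n ∧ Nonempty (H ≃g Graph.wheelGraph n) := by
  have hconn : (H.induce {u | u ≠ y}).Connected := by
    obtain ⟨x, hx, -⟩ := hcard y y y
    have : Nonempty {u | u ≠ y} := ⟨⟨x, hx⟩⟩
    refine ⟨fun a b ↦ ?_⟩
    by_contra hab
    refine hP {c | ∃ h : c ≠ y, (H.induce {u | u ≠ y}).Reachable a ⟨c, h⟩} y y ?_ b
      (fun ⟨_, h⟩ ↦ hab h) b.2 b.2 a ⟨a.2, Reachable.rfl⟩
    rintro c ⟨hc, hac⟩ d hcd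
    by_cases hd : d = y
    · exact .inr (.inl hd)
    · exact .inl ⟨hd, hac.trans (Adj.reachable (G := H.induce {u | u ≠ y})
        (u := ⟨c, hc⟩) (v := ⟨d, hd⟩) hcd)⟩
  obtain ⟨n, hn, ⟨f⟩⟩ := hconn.exists_iso_cycleGraph (by
    rintro ⟨u, hu⟩
    obtain ⟨hyu, a, b, c, hN⟩ := hy u hu
    obtain ⟨p, hup, hpy, -⟩ := hP.exists_adj_ne hcard u y y
    obtain ⟨q, huq, hqy, hqp⟩ := hP.exists_adj_ne hcard u y p
    have : ∀ t, H.Adj u t → t = y ∨ t = p ∨ t = q := by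
      have h1 := hN p hup
      have h2 := hN q huq
      have h3 := hN y hyu.symm
      intro t ht
      have h4 := hN t ht
      clear hP hcard hy hconn
      grind
    rw [Set.ncard_eq_two]
    refine ⟨⟨p, hpy⟩, ⟨q, hqy⟩, by simpa using hqp.symm, ?_⟩
    ext ⟨t, ht⟩
    simp only [mem_neighborSet, comap_adj, Function.Embedding.subtype_apply,
      Set.mem_insert_iff, Subtype.mk.injEq, Set.mem_singleton_iff]
    grind)
  exact ⟨n, hn, nonempty_iso_wheelGraph (fun u hu ↦ (hy u hu).1) f⟩

end SimpleGraph

/-! ### From multigraphs to simple graphs: separations and deletion -/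

namespace Graph

variable {α β : Type*} {G : Graph α β}

/-- Deleting the vertices in `X` leaves no edge between the nonempty sets `S` and `T`. -/
structure IsSeparation (G : Graph α β) (X S T : Set α) : Prop where
  left_nonempty : S.Nonempty
  right_nonempty : T.Nonempty
  mem_iff : ∀ u, u ∈ V(G) ↔ u ∈ S ∨ u ∈ T ∨ u ∈ X
  disj : ∀ u ∈ S, u ∉ T
  left_disj : ∀ u ∈ S, u ∉ X
  right_disj : ∀ u ∈ T, u ∉ X
  not_adj : ∀ s ∈ S, ∀ t ∈ T, ¬ G.Adj s t

lemma deleteVerts_adj {X : Set α} {u v : α} :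
    (G.deleteVerts X).Adj u v ↔ G.Adj u v ∧ u ∉ X ∧ v ∉ X := by
  simp [Adj]

lemma exists_isSeparation {X : Set α} (hX : X ⊆ V(G)) (hne : (V(G) \ X).Nonempty)
    (h : ¬ (G.deleteVerts X).IsConnected) : ∃ S T, G.IsSeparation X S T := by
  set K := (G.deleteVerts X).toSimpleGraph with hK
  have hmem : ∀ {u}, u ∈ V(G.deleteVerts X) ↔ u ∈ V(G) ∧ u ∉ X := by simp
  obtain ⟨x₀, hx₀⟩ := hne
  have hV : Nonempty V(G.deleteVerts X) := ⟨⟨x₀, hmem.2 hx₀⟩⟩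
  have hpre : ¬ K.Preconnected := fun hp ↦ h ⟨hp⟩
  simp only [SimpleGraph.Preconnected, not_forall] at hpre
  obtain ⟨a, b, hab⟩ := hpre
  refine ⟨{u | ∃ h : u ∈ V(G.deleteVerts X), K.Reachable a ⟨u, h⟩},
    {u | ∃ h : u ∈ V(G.deleteVerts X), ¬ K.Reachable a ⟨u, h⟩},
    ⟨a, a.2, SimpleGraph.Reachable.rfl⟩, ⟨b, b.2, hab⟩, fun u ↦ ?_, ?_, ?_, ?_, ?_⟩
  · by_cases hu : u ∈ V(G.deleteVerts X)
    · have := (hmem.1 hu).1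
      by_cases hr : K.Reachable a ⟨u, hu⟩
      · exact iff_of_true this (.inl ⟨hu, hr⟩)
      · exact iff_of_true this (.inr (.inl ⟨hu, hr⟩))
    · refine ⟨fun hG ↦ .inr (.inr ?_), ?_⟩
      · by_contra hn
        exact hu (hmem.2 ⟨hG, hn⟩)
      · rintro (⟨h, -⟩ | ⟨h, -⟩ | h)
        · exact absurd h hu
        · exact absurd h hu
        · exact hX h
  · rintro u ⟨_, h⟩ ⟨_, h'⟩
    exact h' h
  · rintro u ⟨h, -⟩
    exact (hmem.1 h).2
  · rintro u ⟨h, -⟩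
    exact (hmem.1 h).2
  · rintro s ⟨hs, has⟩ t ⟨ht, hat⟩ hst
    refine hat (has.trans (SimpleGraph.Adj.reachable (G := K) ⟨?_, ?_⟩))
    · intro heq
      obtain rfl : s = t := congrArg Subtype.val heq
      exact hat has
    · exact deleteVerts_adj.2 ⟨hst, (hmem.1 hs).2, (hmem.1 ht).2⟩

lemma IsSeparation.not_isConnected {X S T : Set α} (h : G.IsSeparation X S T) :
    ¬ (G.deleteVerts X).IsConnected := by
  intro hc
  have hmem : ∀ {u}, u ∈ V(G.deleteVerts X) ↔ u ∈ V(G) ∧ u ∉ X := by simp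
  obtain ⟨s, hs⟩ := h.left_nonempty
  obtain ⟨t, ht⟩ := h.right_nonempty
  have hr := hc.preconnected ⟨s, hmem.2 ⟨(h.mem_iff s).2 (.inl hs), h.left_disj s hs⟩⟩
    ⟨t, hmem.2 ⟨(h.mem_iff t).2 (.inr (.inl ht)), h.right_disj t ht⟩⟩
  rw [SimpleGraph.reachable_iff_reflTransGen] at hr
  suffices ∀ w, Relation.ReflTransGen (G.deleteVerts X).toSimpleGraph.Adj
      ⟨s, hmem.2 ⟨(h.mem_iff s).2 (.inl hs), h.left_disj s hs⟩⟩ w → w.1 ∈ S from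
    h.disj t (this _ hr) ht
  intro w hw
  induction hw with
  | refl => exact hs
  | @tail u w _ huw ih =>
    have hw := hmem.1 w.2
    rcases (h.mem_iff w).1 hw.1 with h' | h' | h'
    · exact h'
    · exact absurd (deleteVerts_adj.1 huw.2).1 (h.not_adj _ ih _ h')
    · exact absurd h' hw.2

lemma IsVertexConnected.not_isSeparation {k : ℕ} (hG : G.IsVertexConnected k) {X S T : Set α}
    (hX : X.encard < (k : ℕ∞)) : ¬ G.IsSeparation X S T := fun h ↦
  h.not_isConnected (hG.2 X (fun u hu ↦ (h.mem_iff u).2 (.inr (.inr hu))) hX)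

lemma exists_isSeparation_of_not_isVertexConnected {k : ℕ} (hk : (k : ℕ∞) < V(G).encard)
    (hG : ¬ G.IsVertexConnected k) : ∃ X S T, X.encard < (k : ℕ∞) ∧ G.IsSeparation X S T := by
  simp only [IsVertexConnected, hk, true_and, not_forall] at hG
  obtain ⟨X, hX, hXk, hc⟩ := hG
  have hne : (V(G) \ X).Nonempty := by
    rw [Set.sdiff_nonempty]
    exact fun hs ↦ absurd (Set.encard_le_encard hs) (not_le.2 (hXk.trans hk))
  obtain ⟨S, T, h⟩ := exists_isSeparation hX hne hc
  exact ⟨X, S, T, hXk, h⟩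

lemma encard_pair_le (p q : α) : ({p, q} : Set α).encard ≤ 2 := by
  refine (Set.encard_insert_le _ _).trans ?_
  rw [Set.encard_singleton]
  norm_num

/-- The trace of a separation on the type of vertices. -/
lemma IsSeparation.isTripartition_preimage {G' : Graph α β} (hV : V(G') = V(G)) {X S T : Set α}
    (h : G'.IsSeparation X S T) :
    SimpleGraph.IsTripartition (V := V(G)) (Subtype.val ⁻¹' X) (Subtype.val ⁻¹' S)
      (Subtype.val ⁻¹' T) := by
  have hm := h.mem_iff
  rw [hV] at hm
  obtain ⟨s, hs⟩ := h.left_nonempty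
  obtain ⟨t, ht⟩ := h.right_nonempty
  exact ⟨⟨⟨s, (hm s).2 (.inl hs)⟩, hs⟩, ⟨⟨t, (hm t).2 (.inr (.inl ht))⟩, ht⟩,
    fun u ↦ (hm u).1 u.2, fun u ↦ h.disj u, fun u ↦ h.left_disj u, fun u ↦ h.right_disj u⟩

lemma IsVertexConnected.noSmallCut (hG : G.IsVertexConnected 3) :
    G.toSimpleGraph.NoSmallCut := by
  intro A p q hA c hc hcp hcq x hx
  -- The vertices `p` and `q` may lie in `A`; only those outside `A` are deleted.
  let X : Set V(G) := {p, q} \ A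
  have hX : X.encard < 3 := calc
    X.encard ≤ ({p, q} : Set V(G)).encard := Set.encard_le_encard Set.sdiff_subset
    _ ≤ 2 := encard_pair_le p q
    _ < 3 := by norm_num
  refine hG.not_isSeparation (X := Subtype.val '' X) (S := Subtype.val '' A)
    (T := Subtype.val '' (A ∪ X)ᶜ) ?_ ⟨⟨x, x, hx, rfl⟩, ⟨c, c, ?_, rfl⟩, fun u ↦ ?_, ?_, ?_, ?_, ?_⟩
  · rwa [Subtype.val_injective.encard_image]
  · simp only [X]; grind
  · refine ⟨fun hu ↦ ?_, ?_⟩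
    · by_cases h1 : (⟨u, hu⟩ : V(G)) ∈ A
      · exact .inl ⟨_, h1, rfl⟩
      · by_cases h2 : (⟨u, hu⟩ : V(G)) ∈ X
        · exact .inr (.inr ⟨_, h2, rfl⟩)
        · exact .inr (.inl ⟨_, fun h ↦ h.elim h1 h2, rfl⟩)
    · rintro (⟨v, -, rfl⟩ | ⟨v, -, rfl⟩ | ⟨v, -, rfl⟩) <;> exact v.2
  · rintro _ ⟨u, hu, rfl⟩ ⟨v, hv, huv⟩
    obtain rfl := Subtype.val_injective huv
    exact hv (.inl hu)
  · rintro _ ⟨u, hu, rfl⟩ ⟨v, hv, huv⟩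
    obtain rfl := Subtype.val_injective huv
    exact hv.2 hu
  · rintro _ ⟨u, hu, rfl⟩ ⟨v, hv, huv⟩
    obtain rfl := Subtype.val_injective huv
    exact hu (.inr hv)
  · rintro _ ⟨u, hu, rfl⟩ _ ⟨v, hv, rfl⟩ huv
    have hne : u ≠ v := by
      rintro rfl
      exact hv (.inl hu)
    have hvA : v ∉ A := fun h ↦ hv (.inl h)
    have := hA u hu v ⟨hne, huv⟩
    exact hv (.inr ⟨this.resolve_left hvA, hvA⟩)

lemma IsVertexConnected.exists_ne (hG : G.IsVertexConnected 3) (p q r : V(G)) :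
    ∃ x : V(G), x ≠ p ∧ x ≠ q ∧ x ≠ r := by
  by_contra! h
  have hs : V(G) ⊆ {p.1, q.1, r.1} := by
    intro u hu
    have := h ⟨u, hu⟩
    simp only [Set.mem_insert_iff, Set.mem_singleton_iff, Subtype.ext_iff, ne_eq] at this ⊢
    tauto
  have h3 : ({p.1, q.1, r.1} : Set α).encard ≤ 3 := by
    refine (Set.encard_insert_le _ _).trans ?_
    calc _ ≤ (2 : ℕ∞) + 1 := by gcongr; exact encard_pair_le _ _
      _ = 3 := by norm_num
  exact absurd hG.1 (not_lt.2 ((Set.encard_le_encard hs).trans h3))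

lemma IsThreeConnected.isUndeletable (hG : G.IsThreeConnected) {e : β}
    (he : ¬ (G.deleteEdges {e}).IsThreeConnected) {a b : V(G)} (hab : G.IsLink e a b) :
    G.toSimpleGraph.IsUndeletable a b := by
  have := hG.1
  have hV : V(G.deleteEdges {e}) = V(G) := rfl
  obtain ⟨X, S, T, hX, h⟩ := exists_isSeparation_of_not_isVertexConnected (k := 3)
    (G := G.deleteEdges {e}) hG.2.1 (fun hc ↦ he ⟨Simple.anti deleteEdges_le, hc⟩)
  have hlink : ∀ s ∈ S, ∀ t ∈ T, G.Adj s t → G.IsLink e s t := by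
    rintro s hs t ht ⟨f, hf⟩
    by_cases hfe : f = e
    · rwa [← hfe]
    · exact absurd ⟨f, by simpa [hfe] using hf⟩ (h.not_adj s hs t ht)
  have hX2 : (Subtype.val ⁻¹' X : Set V(G)).encard ≤ 2 := by
    rw [← Subtype.val_injective.encard_image]
    refine (Set.encard_le_encard (Set.image_preimage_subset _ _)).trans ?_
    exact Order.le_of_lt_add_one hX
  have htri := h.isTripartition_preimage hV
  -- Some edge of `G` must cross, as otherwise `X` would separate `G` itself; the only candidate is
  -- `e`.
  obtain ⟨s, hs, t, ht, hst⟩ : ∃ s ∈ S, ∃ t ∈ T, G.Adj s t := by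
    by_contra! hn
    exact hG.2.not_isSeparation hX ⟨h.1, h.2, h.3, h.4, h.5, h.6, hn⟩
  rcases hab.eq_and_eq_or_eq_and_eq (hlink s hs t ht hst) with ⟨rfl, rfl⟩ | ⟨rfl, rfl⟩
  · refine ⟨_, _, _, hX2, htri, hs, ht, fun u hu v hv huv ↦ ?_⟩
    rcases hab.eq_and_eq_or_eq_and_eq (hlink u hu v hv huv.2) with ⟨h1, h2⟩ | ⟨h1, h2⟩
    · exact ⟨Subtype.ext h1.symm, Subtype.ext h2.symm⟩
    · exact absurd (h1 ▸ hs) (fun h' ↦ h.disj _ h' hv)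
  · refine ⟨_, _, _, hX2, htri.symm, ht, hs, fun u hu v hv huv ↦ ?_⟩
    rcases hab.eq_and_eq_or_eq_and_eq (hlink v hv u hu huv.2.symm) with ⟨h1, h2⟩ | ⟨h1, h2⟩
    · exact absurd (h1 ▸ ht) (h.disj _ hv)
    · exact ⟨Subtype.ext h1.symm, Subtype.ext h2.symm⟩

/-! ### Contraction -/

lemma quot_mk_eq_iff {e : β} {x y : α} (hxy : G.IsLink e x y) {u v : α} :
    Quot.mk (G.IsLink e) u = Quot.mk (G.IsLink e) v ↔
      u = v ∨ (u = x ∧ v = y) ∨ (u = y ∧ v = x) := by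
  classical
  constructor
  · intro h
    -- The retraction that sends `y` to `x` is constant on classes and separates different ones.
    let f : Quot (G.IsLink e) → α := Quot.lift (fun z ↦ if z = y then x else z) (by
      intro a b hab
      rcases hxy.eq_and_eq_or_eq_and_eq hab with ⟨rfl, rfl⟩ | ⟨rfl, rfl⟩ <;> simp)
    have hf := congrArg f h
    simp only [f] at hf
    grind
  · rintro (rfl | ⟨rfl, rfl⟩ | ⟨rfl, rfl⟩)
    · rfl
    · exact Quot.sound hxy
    · exact Quot.sound hxy.symm

lemma contractEdge_isLink {e f : β} {p q : Quot (G.IsLink e)} :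
    (G.contractEdge e).IsLink f p q ↔
      ∃ u v, (G.IsLink f u v ∧ f ≠ e) ∧ Quot.mk _ u = p ∧ Quot.mk _ v = q := by
  simp [contractEdge, Relation.Map]

lemma contractEdge_simple [G.Simple] {e : β} {x y : α} (hxy : G.IsLink e x y)
    (hno : ∀ z, ¬ (G.Adj x z ∧ G.Adj y z)) : (G.contractEdge e).Simple where
  not_isLoopAt := by
    intro f p hp
    obtain ⟨u, v, ⟨huv, hfe⟩, hu, hv⟩ := contractEdge_isLink.1 hp
    rcases (quot_mk_eq_iff hxy).1 (hu.trans hv.symm) with rfl | ⟨rfl, rfl⟩ | ⟨rfl, rfl⟩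
    · exact huv.ne rfl
    · exact hfe (huv.eq hxy)
    · exact hfe (huv.eq hxy.symm)
  eq_of_isLink := by
    intro f g p q hf hg
    obtain ⟨u, v, ⟨huv, hfe⟩, hu, hv⟩ := contractEdge_isLink.1 hf
    obtain ⟨u', v', ⟨huv', hge⟩, hu', hv'⟩ := contractEdge_isLink.1 hg
    have hne : ∀ {f u v}, G.IsLink f u v → f ≠ e → ¬ (u = x ∧ v = y) ∧ ¬ (u = y ∧ v = x) := by
      intro f u v h hfe
      constructor
      · rintro ⟨rfl, rfl⟩; exact hfe (h.eq hxy)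
      · rintro ⟨rfl, rfl⟩; exact hfe (h.eq hxy.symm)
    have h1 := hne huv hfe
    have h2 := hne huv' hge
    have h3 := huv.ne
    have h4 := huv'.ne
    rcases (quot_mk_eq_iff hxy).1 (hu.trans hu'.symm) with rfl | ⟨rfl, rfl⟩ | ⟨rfl, rfl⟩ <;>
    rcases (quot_mk_eq_iff hxy).1 (hv.trans hv'.symm) with rfl | ⟨rfl, rfl⟩ | ⟨rfl, rfl⟩
    · exact huv.eq huv'
    · exact absurd ⟨huv.symm.adj, huv'.symm.adj⟩ (hno u)
    · exact absurd ⟨huv'.symm.adj, huv.symm.adj⟩ (hno u)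
    · exact absurd ⟨huv.adj, huv'.adj⟩ (hno v)
    · simp at h3
    · simp at h1
    · exact absurd ⟨huv'.adj, huv.adj⟩ (hno v)
    · simp at h1
    · simp at h3

/-- Besides the contracted vertex there are two neighbours of `x` and one neighbour of `y`. They are
distinct because `x` and `y` have no common neighbour. -/
lemma IsThreeConnected.three_lt_encard_contractEdge (hG : G.IsThreeConnected) {e : β}
    {x y : V(G)} (hxy : G.IsLink e x y) (hno : ∀ z, ¬ (G.Adj x z ∧ G.Adj y z)) :
    3 < V(G.contractEdge e).encard := by
  have hP := hG.2.noSmallCut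
  obtain ⟨p, hp, hpy, -⟩ := hP.exists_adj_ne hG.2.exists_ne x y y
  obtain ⟨q, hq, hqy, hqp⟩ := hP.exists_adj_ne hG.2.exists_ne x y p
  obtain ⟨r, hr, hrx, -⟩ := hP.exists_adj_ne hG.2.exists_ne y x x
  have hrp : r ≠ p := by rintro rfl; exact hno r ⟨hp.2, hr.2⟩
  have hrq : r ≠ q := by rintro rfl; exact hno r ⟨hq.2, hr.2⟩
  have hsub : (fun v : V(G) ↦ Quot.mk (G.IsLink e) v.1) '' {x, p, q, r} ⊆ V(G.contractEdge e) := by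
    rintro _ ⟨v, -, rfl⟩
    exact ⟨v, v.2, rfl⟩
  refine lt_of_lt_of_le ?_ (Set.encard_le_encard hsub)
  have hpx := hp.ne
  have hqx := hq.ne
  have hry := hr.ne
  rw [Set.InjOn.encard_image]
  · rw [Set.encard_insert_of_notMem, Set.encard_insert_of_notMem, Set.encard_pair]
    · norm_num
    all_goals grind
  · intro u hu v hv huv
    have := (quot_mk_eq_iff hxy).1 huv
    simp only [Set.mem_insert_iff, Set.mem_singleton_iff] at hu hv
    grind

lemma IsSeparation.preimage_contractEdge {e : β} {X S T : Set (Quot (G.IsLink e))}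
    (h : (G.contractEdge e).IsSeparation X S T) :
    G.IsSeparation (V(G) ∩ Quot.mk _ ⁻¹' X) (V(G) ∩ Quot.mk _ ⁻¹' S)
      (V(G) ∩ Quot.mk _ ⁻¹' T) := by
  have hV : V(G.contractEdge e) = Quot.mk _ '' V(G) := rfl
  have hm := h.mem_iff
  rw [hV] at hm
  refine ⟨?_, ?_, fun u ↦ ?_, ?_, ?_, ?_, ?_⟩
  · obtain ⟨s, hs⟩ := h.left_nonempty
    obtain ⟨u, hu, rfl⟩ := (hm s).2 (.inl hs)
    exact ⟨u, hu, hs⟩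
  · obtain ⟨s, hs⟩ := h.right_nonempty
    obtain ⟨u, hu, rfl⟩ := (hm s).2 (.inr (.inl hs))
    exact ⟨u, hu, hs⟩
  · refine ⟨fun hu ↦ ?_, ?_⟩
    · rcases (hm _).1 ⟨u, hu, rfl⟩ with h' | h' | h'
      · exact .inl ⟨hu, h'⟩
      · exact .inr (.inl ⟨hu, h'⟩)
      · exact .inr (.inr ⟨hu, h'⟩)
    · rintro (h' | h' | h') <;> exact h'.1
  · exact fun u hu hu' ↦ h.disj _ hu.2 hu'.2
  · exact fun u hu hu' ↦ h.left_disj _ hu.2 hu'.2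
  · exact fun u hu hu' ↦ h.right_disj _ hu.2 hu'.2
  · rintro s hs t ht ⟨f, hf⟩
    by_cases hfe : f = e
    · subst hfe
      exact h.disj _ hs.2 (by
        have : Quot.mk (G.IsLink f) s = Quot.mk _ t := Quot.sound hf
        rw [this]
        exact ht.2)
    · exact h.not_adj _ hs.2 _ ht.2 ⟨f, contractEdge_isLink.2 ⟨s, t, ⟨hf, hfe⟩, rfl, rfl⟩⟩

/-- Without a common neighbour the contraction is simple and large enough, so it has a separator of
at most two vertices. This must contain the contracted vertex, since otherwise it would lift to an
equally small separator of `G`. Hence its preimage is `{x, y, w}`. -/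
lemma IsThreeConnected.isUncontractible (hG : G.IsThreeConnected) {e : β}
    (he : ¬ (G.contractEdge e).IsThreeConnected) {x y : V(G)} (hxy : G.IsLink e x y) :
    G.toSimpleGraph.IsUncontractible x y := by
  have := hG.1
  by_cases hno : ∃ z, G.Adj x z ∧ G.Adj y z
  · obtain ⟨z, hxz, hyz⟩ := hno
    exact .inl ⟨⟨z, hxz.right_mem⟩, (toSimpleGraph_adj_iff _ _).2 hxz,
      (toSimpleGraph_adj_iff _ _).2 hyz⟩
  push Not at hno
  right
  obtain ⟨X, S, T, hX, h⟩ := exists_isSeparation_of_not_isVertexConnected (k := 3)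
    (hG.three_lt_encard_contractEdge hxy (fun z hz ↦ hno z hz.1 hz.2))
    (fun hc ↦ he ⟨contractEdge_simple hxy (fun z hz ↦ hno z hz.1 hz.2), hc⟩)
  have h' := h.preimage_contractEdge
  have hxX : Quot.mk _ x.1 ∈ X := by
    by_contra hxX
    refine hG.2.not_isSeparation (lt_of_le_of_lt ?_ hX) h'
    have hinj : Set.InjOn (Quot.mk (G.IsLink e)) (V(G) ∩ Quot.mk _ ⁻¹' X) := by
      rintro u ⟨-, hu⟩ v ⟨-, hv⟩ huv
      rcases (quot_mk_eq_iff hxy).1 huv with rfl | ⟨rfl, rfl⟩ | ⟨rfl, rfl⟩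
      · rfl
      · exact absurd hu hxX
      · exact absurd hv hxX
    rw [← hinj.encard_image]
    refine Set.encard_le_encard ?_
    rintro _ ⟨u, hu, rfl⟩
    exact hu.2
  obtain ⟨w', rfl⟩ := SimpleGraph.exists_eq_pair_of_encard_le_two (Order.le_of_lt_add_one hX) hxX
  obtain ⟨w, hw, rfl⟩ : w' ∈ Quot.mk (G.IsLink e) '' V(G) :=
    (h.mem_iff w').2 (.inr (.inr (by simp)))
  have hset : ({x, y, ⟨w, hw⟩} : Set V(G)) =
      Subtype.val ⁻¹' (V(G) ∩ Quot.mk (G.IsLink e) ⁻¹' {Quot.mk _ x.1, Quot.mk _ w}) := by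
    ext ⟨v, hv⟩
    simp only [Set.mem_insert_iff, Set.mem_singleton_iff, Set.mem_preimage, Set.mem_inter_iff, hv,
      true_and, quot_mk_eq_iff hxy, Subtype.ext_iff]
    grind
  exact ⟨⟨w, hw⟩, _, _, hset ▸ h'.isTripartition_preimage rfl,
    fun s hs t ht hst ↦ h'.not_adj s hs t ht hst.2⟩

end Graph

theorem mainTheorem5 {α β : Type*} (G : Graph α β) (hfin : V(G).Finite)
    (hG : G.IsMinimallyThreeConnected) : G.IsWheel := by
  obtain ⟨h3, hmin⟩ := hG
  have := hfin.to_subtype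
  have : Nonempty V(G) :=
    (Set.encard_pos.1 (lt_of_le_of_lt zero_le h3.2.1)).to_subtype
  have hP := h3.2.noSmallCut
  obtain ⟨y, hy⟩ := hP.exists_hub h3.2.exists_ne
    (fun a b ⟨_, e, he⟩ ↦ h3.isUndeletable (hmin e he.edge_mem).1 he)
    (fun a b ⟨_, e, he⟩ ↦ h3.isUncontractible (hmin e he.edge_mem).2 he)
  exact ⟨h3.1, hP.exists_iso_wheelGraph h3.2.exists_ne hy⟩
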